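/- Let $n\ge 2$ be an integer, let $0<\mu<n$, and let $u\in C^n(\mathbb R^n)$ be real-valued. Put \[ v(x)=\int_{\mathbb R^n}\frac{e^{\frac{2n-\mu}{2}u(y)}}{|x-y|^{\mu}}\,dy,\qquad \beta_n=2^{n-1}\,\Gamma\!\left(\tfrac n2+1\right)\Gamma\!\left(\tfrac n2\right)\omega_n, \] where $\omega_n$ is the volume of the unit ball of $\mathbb R^n$. Suppose that \[ \int_{\mathbb R^n}e^{\frac{2n-\mu}{2}u(y)}\,dy<\infty,\qquad \alpha:=\frac1{\beta_n}\int_{\mathbb R^n}v(y)\,e^{\frac{2n-\mu}{2}u(y)}\,dy<\infty, \] and that there is a constant $C\in\mathbb R$ such that for every $x\in\mathbb R^n$ \[ u(x)=\frac1{\beta_n}\int_{\mathbb R^n}\ln\!\left(\frac{|y|+1}{|x-y|}\right)v(y)\,e^{\frac{2n-\mu}{2}u(y)}\,dy+C . \] Then $\alpha=2$. -/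

import Mathlib

open MeasureTheory

namespace Choquard

noncomputable section

/-- The density `y ↦ e^{(2n - μ) u(y) / 2}`. -/
def density {n : ℕ} (μ : ℝ) (u : EuclideanSpace ℝ (Fin n) → ℝ)
    (y : EuclideanSpace ℝ (Fin n)) : ℝ :=
  Real.exp ((2 * (n : ℝ) - μ) / 2 * u y)

/-- The Riesz-type potential `v(x) = ∫ e^{(2n - μ) u(y) / 2} / |x - y|^μ dy`.
For continuous `u` with integrable density and `0 < μ < n` the integral converges at every `x`. -/
def potential {n : ℕ} (μ : ℝ) (u : EuclideanSpace ℝ (Fin n) → ℝ)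
    (x : EuclideanSpace ℝ (Fin n)) : ℝ :=
  ∫ y : EuclideanSpace ℝ (Fin n), density μ u y / ‖x - y‖ ^ μ

/-- `β_n = 2^{n-1} (n/2)! (n/2 - 1)! ω_n`, where `ω_n` is the volume of the unit ball of `ℝⁿ` and
`s! = Γ(s + 1)`, as needed for odd `n`. -/
def betaConst (n : ℕ) : ℝ :=
  2 ^ (n - 1) * Real.Gamma ((n : ℝ) / 2 + 1) * Real.Gamma ((n : ℝ) / 2) *
    volume.real (Metric.ball (0 : EuclideanSpace ℝ (Fin n)) 1)

/-- `α = β_n⁻¹ ∫ v(y) e^{(2n - μ) u(y) / 2} dy`. -/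
def alpha {n : ℕ} (μ : ℝ) (u : EuclideanSpace ℝ (Fin n) → ℝ) : ℝ :=
  1 / betaConst n * ∫ y : EuclideanSpace ℝ (Fin n), potential μ u y * density μ u y

/-- `u` solves the integral equation
`u(x) = β_n⁻¹ ∫ ln ((|y| + 1) / |x - y|) v(y) e^{(2n - μ) u(y) / 2} dy + C` at every point `x`,
for some real constant `C`. -/
def SolvesIntegralEquation {n : ℕ} (μ : ℝ) (u : EuclideanSpace ℝ (Fin n) → ℝ) : Prop :=
  ∃ C : ℝ, ∀ x : EuclideanSpace ℝ (Fin n),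
    u x = 1 / betaConst n *
        (∫ y : EuclideanSpace ℝ (Fin n),
          Real.log ((‖y‖ + 1) / ‖x - y‖) * (potential μ u y * density μ u y)) + C

end

end Choquard

/-!
The proof is a Pohozaev argument in integrated form. Write `f = e^{c u}` with `c = (2n - μ) / 2`,
`v(x) = ∫ f(y) / ‖x - y‖^μ dy`, `w = v f` and `W = ∫ w = β_n α`; thus `W` is also the Riesz energy
`∬ f(x) f(y) / ‖x - y‖^μ`. For a compactly supported `C¹` cutoff `ψ` put `X(x) = ψ(x) x` and
`Φ_t = id + t X`, a diffeomorphism for small `t`. Substituting `Φ_t` in both variables does not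
change the energy, while it multiplies the integrand by some `exp q_t`. Since `1 + q_t ≤ exp q_t`,
the integral of `q_t` against the energy integrand is at most zero
(`exists_first_variation_le`). In `q_t` the function `u` occurs only through `u ∘ Φ_t - u`, which
the integral equation and `log a ≤ a - 1` bound from below by the relative changes of the
distances `‖x - z‖` (`neg_integral_relChange_le`). Dividing by `t`, letting `t → 0⁺` and using the
antisymmetry of `x - z` gives, for `ψ` and for `-ψ`, the two halves of

  `2 ∫ (div X) w - μ ∬ A(x, y) f(x) f(y) / ‖x - y‖^μ - (c / β_n) ∬ A(x, y) w(x) w(y) = 0`,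
  `A(x, y) = ⟪X x - X y, x - y⟫ / ‖x - y‖²`

(`pohozaev_eq`). Dilating the cutoff leaves the Lipschitz constant of `X`, hence the bound on `A`,
unchanged, and `div X → n`, `A → 1`. Dominated convergence then gives
`(2n - μ) W = (c / β_n) W²` (`mass_identity`), and `W > 0` forces `α = W / β_n = 2`.

Since `X` has compact support and bounded Lipschitz constant, integrability of `w` and of the energy
integrand is all the control at infinity that the limits require. Dimension at least two enters
through the local integrability of `‖x‖⁻¹`.
-/

namespace Choquard

open Filter Topology

set_option linter.unusedSectionVars false

variable {E : Type*} [NormedAddCommGroup E] [InnerProductSpace ℝ E] [FiniteDimensional ℝ E]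
  [MeasurableSpace E] [BorelSpace E]

/-! ### Riesz and logarithmic potentials of locally bounded densities -/

/-- Boundedness on every ball centred at the origin. -/
def LocallyBounded (f : E → ℝ) : Prop :=
  ∀ R : ℝ, ∃ M : ℝ, ∀ x, ‖x‖ ≤ R → |f x| ≤ M

lemma LocallyBounded.of_continuous {f : E → ℝ} (hf : Continuous f) : LocallyBounded f := by
  intro R
  obtain ⟨M, hM⟩ := (isCompact_closedBall (0 : E) R).exists_bound_of_continuousOn hf.continuousOn
  exact ⟨M, fun x hx => hM x (by simpa using hx)⟩

lemma LocallyBounded.mul {f g : E → ℝ} (hf : LocallyBounded f) (hg : LocallyBounded g) :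
    LocallyBounded fun x => f x * g x := by
  intro R
  obtain ⟨M, hM⟩ := hf R
  obtain ⟨N, hN⟩ := hg R
  refine ⟨M * N, fun x hx => ?_⟩
  rw [abs_mul]
  exact mul_le_mul (hM x hx) (hN x hx) (abs_nonneg _) ((abs_nonneg _).trans (hM x hx))

/-- The part of the Riesz kernel `‖z‖⁻ˢ` near its singularity. -/
noncomputable def nearKernel (s : ℝ) (z : E) : ℝ :=
  (Metric.ball (0 : E) 1).indicator (fun z => 1 / ‖z‖ ^ s) z

lemma nearKernel_nonneg (s : ℝ) (z : E) : 0 ≤ nearKernel s z :=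
  Set.indicator_nonneg (fun _ _ => by positivity) z

lemma integrable_nearKernel {s : ℝ} (hs0 : 0 < s) (hs : s < Module.finrank ℝ E) :
    Integrable (nearKernel s : E → ℝ) := by
  have hd : 1 ≤ Module.finrank ℝ E := by
    have : (0 : ℝ) < Module.finrank ℝ E := hs0.trans hs
    exact_mod_cast this
  unfold nearKernel
  rw [integrable_indicator_iff measurableSet_ball]
  refine integrableOn_ball_of_norm_le_rpow (C := 1) (α := s) hd hs ?_ ?_
  · refine Filter.Eventually.of_forall fun z => ?_
    rw [Real.norm_of_nonneg (by positivity), Real.rpow_neg (norm_nonneg _), one_mul, one_div]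
  · exact Measurable.aestronglyMeasurable (by fun_prop)

/-- The pointwise splitting of a Riesz-type integrand into a locally integrable singular part and
a part dominated by the density. -/
lemma abs_div_rpow_le {f : E → ℝ} {s R M : ℝ} (hs0 : 0 < s)
    (hM : ∀ x, ‖x‖ ≤ R + 1 → |f x| ≤ M) {x : E} (hx : ‖x‖ ≤ R) (y : E) :
    |f y| / ‖x - y‖ ^ s ≤ M * nearKernel s (x - y) + |f y| := by
  have hM0 : 0 ≤ M := (abs_nonneg _).trans (hM x (by linarith))
  by_cases h : ‖x - y‖ < 1
  · have hy : ‖y‖ ≤ R + 1 := by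
      have := norm_sub_norm_le y x
      rw [norm_sub_rev] at this
      linarith
    have : nearKernel s (x - y) = 1 / ‖x - y‖ ^ s :=
      Set.indicator_of_mem (by simpa using h) _
    rw [this, div_eq_mul_one_div]
    have := mul_le_mul_of_nonneg_right (hM y hy) (by positivity : 0 ≤ 1 / ‖x - y‖ ^ s)
    linarith [abs_nonneg (f y)]
  · have h1 : 1 ≤ ‖x - y‖ ^ s := Real.one_le_rpow (not_lt.mp h) hs0.le
    have := div_le_self (abs_nonneg (f y)) h1
    have := mul_nonneg hM0 (nearKernel_nonneg s (x - y))
    linarith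

lemma integrable_div_rpow {f : E → ℝ} {s : ℝ} (hs0 : 0 < s) (hs : s < Module.finrank ℝ E)
    (hf : Integrable f) (hb : LocallyBounded f) (x : E) :
    Integrable fun y => f y / ‖x - y‖ ^ s := by
  obtain ⟨M, hM⟩ := hb (‖x‖ + 1)
  refine (((integrable_nearKernel hs0 hs).comp_sub_left x).const_mul M |>.add hf.abs).mono'
    (hf.aestronglyMeasurable.mul (f := f) (g := fun y => (‖x - y‖ ^ s)⁻¹)
      (Measurable.aestronglyMeasurable (by fun_prop))) ?_
  refine Filter.Eventually.of_forall fun y => ?_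
  rw [Real.norm_eq_abs, abs_div, abs_of_nonneg (by positivity : 0 ≤ ‖x - y‖ ^ s)]
  exact abs_div_rpow_le hs0 hM le_rfl y

lemma locallyBounded_integral_div_rpow {f : E → ℝ} {s : ℝ} (hs0 : 0 < s)
    (hs : s < Module.finrank ℝ E) (hf : Integrable f) (hb : LocallyBounded f) :
    LocallyBounded fun x => ∫ y, f y / ‖x - y‖ ^ s := by
  intro R
  obtain ⟨M, hM⟩ := hb (R + 1)
  refine ⟨M * (∫ z : E, nearKernel s z) + ∫ y, |f y|, fun x hx => ?_⟩
  have hint := (integrable_nearKernel (E := E) hs0 hs).comp_sub_left x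
  calc |∫ y, f y / ‖x - y‖ ^ s| ≤ ∫ y, |f y / ‖x - y‖ ^ s| := abs_integral_le_integral_abs
    _ ≤ ∫ y, (M * nearKernel s (x - y) + |f y|) := by
        refine integral_mono (integrable_div_rpow hs0 hs hf hb x).abs
          ((hint.const_mul M).add hf.abs) fun y => ?_
        simp only [abs_div]
        rw [abs_of_nonneg (by positivity : 0 ≤ ‖x - y‖ ^ s)]
        exact abs_div_rpow_le hs0 hM hx y
    _ = _ := by
        rw [integral_add (hint.const_mul M) hf.abs, integral_const_mul,
          integral_sub_left_eq_self (fun z => nearKernel s z) volume x]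

/-- The logarithmic kernel has at worst the singularity of `‖x - y‖⁻¹`, and stays bounded as
`y → ∞`. -/
lemma abs_log_kernel_le (x y : E) :
    |Real.log ((‖y‖ + 1) / ‖x - y‖)| ≤ Real.log (‖x‖ + 2) + 1 / ‖x - y‖ := by
  have hx := norm_nonneg x
  have hy := norm_nonneg y
  have hL : 0 ≤ Real.log (‖x‖ + 2) := Real.log_nonneg (by linarith)
  rcases (norm_nonneg (x - y)).eq_or_lt with h | h
  · simpa [← h] using hL
  have h1 : ‖y‖ ≤ ‖x‖ + ‖x - y‖ := by
    have := norm_sub_norm_le y x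
    rw [norm_sub_rev] at this
    linarith
  have h2 : ‖x - y‖ ≤ ‖x‖ + ‖y‖ := norm_sub_le x y
  rw [abs_le]
  constructor
  · have : -Real.log (‖x‖ + 2) ≤ Real.log ((‖y‖ + 1) / ‖x - y‖) := by
      rw [← Real.log_inv]
      refine Real.log_le_log (by positivity) ?_
      rw [inv_eq_one_div, div_le_div_iff₀ (by positivity) h]
      nlinarith
    have : 0 ≤ 1 / ‖x - y‖ := by positivity
    linarith
  · calc Real.log ((‖y‖ + 1) / ‖x - y‖)
        ≤ Real.log ((‖x‖ + 2) * (1 + 1 / ‖x - y‖)) := by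
          refine Real.log_le_log (by positivity) ?_
          rw [div_le_iff₀ h]
          have : (1 + 1 / ‖x - y‖) * ‖x - y‖ = ‖x - y‖ + 1 := by field_simp
          rw [mul_assoc, this]
          nlinarith
      _ = Real.log (‖x‖ + 2) + Real.log (1 + 1 / ‖x - y‖) :=
          Real.log_mul (by positivity) (by positivity)
      _ ≤ _ := by
          have := Real.log_le_sub_one_of_pos (by positivity : 0 < 1 + 1 / ‖x - y‖)
          linarith

lemma integrable_log_kernel_mul {w : E → ℝ} (hd : 2 ≤ Module.finrank ℝ E)
    (hw : Integrable w) (hb : LocallyBounded w) (x : E) :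
    Integrable fun y => Real.log ((‖y‖ + 1) / ‖x - y‖) * w y := by
  have h1 : (1 : ℝ) < Module.finrank ℝ E := by exact_mod_cast hd
  refine ((hw.abs.const_mul (Real.log (‖x‖ + 2))).add
    (integrable_div_rpow one_pos h1 hw hb x).abs).mono'
    (AEStronglyMeasurable.mul (Measurable.aestronglyMeasurable (by fun_prop))
      hw.aestronglyMeasurable) ?_
  refine Filter.Eventually.of_forall fun y => ?_
  simp only [Pi.add_apply, Real.norm_eq_abs, abs_mul, abs_div, Real.rpow_one, abs_norm]
  calc _ ≤ (Real.log (‖x‖ + 2) + 1 / ‖x - y‖) * |w y| :=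
        mul_le_mul_of_nonneg_right (abs_log_kernel_le x y) (abs_nonneg _)
    _ = _ := by ring

/-! ### Radial deformations -/

/-- The radial vector field `x ↦ ψ(x) x`. -/
def radialField (ψ : E → ℝ) (x : E) : E := ψ x • x

/-- The divergence of `radialField ψ`. -/
noncomputable def radialDiv (ψ : E → ℝ) (x : E) : ℝ :=
  Module.finrank ℝ E * ψ x + fderiv ℝ ψ x x

/-- The deformation `x ↦ x + t ψ(x) x` generated by `radialField ψ`. -/
def deform (ψ : E → ℝ) (t : ℝ) (x : E) : E := x + t • radialField ψ x

/-- The relative rate `⟪X x - X y, x - y⟫ / ‖x - y‖²` at which `X = radialField ψ` separates `x`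
and `y`; it is `0` on the diagonal. -/
noncomputable def stretch (ψ : E → ℝ) (x y : E) : ℝ :=
  inner ℝ (radialField ψ x - radialField ψ y) (x - y) / ‖x - y‖ ^ 2

lemma abs_stretch_le {ψ : E → ℝ} {L : NNReal} (hL : LipschitzWith L (radialField ψ)) (x y : E) :
    |stretch ψ x y| ≤ L := by
  unfold stretch
  rw [abs_div, abs_of_nonneg (sq_nonneg ‖x - y‖)]
  refine div_le_of_le_mul₀ (by positivity) L.2 ?_
  calc _ ≤ ‖radialField ψ x - radialField ψ y‖ * ‖x - y‖ := abs_real_inner_le_norm _ _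
    _ ≤ (L * ‖x - y‖) * ‖x - y‖ := by gcongr; exact hL.norm_sub_le x y
    _ = _ := by ring

lemma measurable_stretch {ψ : E → ℝ} (hψ : Continuous ψ) :
    Measurable fun p : E × E => stretch ψ p.1 p.2 := by
  unfold stretch radialField
  refine Measurable.div ?_ ?_
  · exact Continuous.measurable (by fun_prop)
  · exact Continuous.measurable (by fun_prop)

lemma contDiff_radialField {ψ : E → ℝ} (hψ : ContDiff ℝ 1 ψ) : ContDiff ℝ 1 (radialField ψ) :=
  hψ.smul contDiff_id

lemma exists_lipschitzWith_radialField {ψ : E → ℝ} (hψ : ContDiff ℝ 1 ψ)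
    (hc : HasCompactSupport ψ) : ∃ L, LipschitzWith L (radialField ψ) :=
  ⟨_, (contDiff_radialField hψ).lipschitzWith_of_hasCompactSupport
    (hc.smul_right (f' := fun x => x)) one_ne_zero |>.choose_spec⟩

lemma continuous_fderiv_self {ψ : E → ℝ} (hψ : ContDiff ℝ 1 ψ) :
    Continuous fun x => fderiv ℝ ψ x x :=
  (hψ.continuous_fderiv one_ne_zero).clm_apply continuous_id

lemma exists_bound_of_compactSupport {ψ : E → ℝ} (hψ : ContDiff ℝ 1 ψ)
    (hc : HasCompactSupport ψ) : ∃ B, 0 < B ∧ ∀ x, |ψ x| ≤ B ∧ |fderiv ℝ ψ x x| ≤ B := by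
  obtain ⟨B₁, h₁⟩ := hc.exists_bound_of_continuous hψ.continuous
  obtain ⟨B₂, h₂⟩ := HasCompactSupport.exists_bound_of_continuous
    (f := fun x => fderiv ℝ ψ x x)
    ((hc.fderiv ℝ).mono' fun x hx => subset_tsupport _ fun h => hx (by simp [h]))
    (continuous_fderiv_self hψ)
  refine ⟨max (max B₁ B₂) 1, by positivity, fun x => ⟨(h₁ x).trans ?_, (h₂ x).trans ?_⟩⟩ <;> simp

/-- The derivative of `deform ψ t` at `x`. -/
noncomputable def deformDeriv (ψ : E → ℝ) (t : ℝ) (x : E) : E →L[ℝ] E :=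
  ContinuousLinearMap.id ℝ E + t • (ψ x • ContinuousLinearMap.id ℝ E + (fderiv ℝ ψ x).smulRight x)

lemma hasFDerivAt_deform {ψ : E → ℝ} (hψ : ContDiff ℝ 1 ψ) (t : ℝ) (x : E) :
    HasFDerivAt (deform ψ t) (deformDeriv ψ t x) x :=
  (hasFDerivAt_id x).add
    (((hψ.differentiable one_ne_zero x).hasFDerivAt.smul (hasFDerivAt_id x)).const_smul t)

/-- The Jacobian of a radial deformation: the derivative is a rank-one perturbation of a
homothety. -/
lemma det_fderiv_deform (ψ : E → ℝ) (t : ℝ) (x : E) (hd : 1 ≤ Module.finrank ℝ E)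
    (h : 1 + t * ψ x ≠ 0) :
    (deformDeriv ψ t x).det =
      (1 + t * ψ x) ^ (Module.finrank ℝ E - 1) * (1 + t * (ψ x + fderiv ℝ ψ x x)) := by
  have key : (deformDeriv ψ t x : E →ₗ[ℝ] E) =
      (1 + t * ψ x) • LinearMap.transvection
        (((1 + t * ψ x)⁻¹ * t) • (fderiv ℝ ψ x : E →ₗ[ℝ] ℝ)) x := by
    ext y
    simp only [deformDeriv, LinearMap.transvection.apply, ContinuousLinearMap.coe_coe,
      LinearMap.smul_apply, add_apply, smul_apply,
      ContinuousLinearMap.id_apply, ContinuousLinearMap.smulRight_apply, smul_add, smul_smul,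
      smul_eq_mul]
    rw [show (1 + t * ψ x) * ((1 + t * ψ x)⁻¹ * t * (fderiv ℝ ψ x) y) = t * fderiv ℝ ψ x y by
      field_simp]
    module
  rw [ContinuousLinearMap.det, key, LinearMap.det_smul, LinearMap.transvection.det]
  obtain ⟨k, hk⟩ : ∃ k, Module.finrank ℝ E = k + 1 := ⟨_, (Nat.sub_add_cancel hd).symm⟩
  simp only [hk, LinearMap.smul_apply, ContinuousLinearMap.coe_coe, smul_eq_mul,
    Nat.add_sub_cancel]
  field_simp
  ring

lemma sub_le_log_one_add {s : ℝ} (hs : |s| ≤ 1 / 2) : s - 2 * s ^ 2 ≤ Real.log (1 + s) := by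
  obtain ⟨h1, h2⟩ := abs_le.mp hs
  have hpos : 0 < 1 + s := by linarith
  refine le_trans ?_ (Real.one_sub_inv_le_log_of_pos hpos)
  rw [show 1 - (1 + s)⁻¹ = s / (1 + s) by field_simp; ring, le_div_iff₀ hpos]
  nlinarith [sq_nonneg s]

/-- First-order lower bound for the Jacobian of `deform ψ t`, uniform in the base point. -/
lemma exp_le_abs_det {ψ : E → ℝ} {B : ℝ} (hd : 1 ≤ Module.finrank ℝ E)
    (hB : ∀ x, |ψ x| ≤ B ∧ |fderiv ℝ ψ x x| ≤ B) {t : ℝ} (ht : |t| * B ≤ 1 / 4) (x : E) :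
    Real.exp (t * radialDiv ψ x - t ^ 2 * ((2 * Module.finrank ℝ E + 8) * B ^ 2)) ≤
      |(deformDeriv ψ t x).det| := by
  obtain ⟨h1, h2⟩ := hB x
  have hB0 : 0 ≤ B := (abs_nonneg _).trans h1
  have h3 : |ψ x + fderiv ℝ ψ x x| ≤ 2 * B := (abs_add_le _ _).trans (by linarith)
  have ha : |t * ψ x| ≤ 1 / 2 := by
    rw [abs_mul]
    have := mul_le_mul_of_nonneg_left h1 (abs_nonneg t)
    linarith
  have hb : |t * (ψ x + fderiv ℝ ψ x x)| ≤ 1 / 2 := by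
    rw [abs_mul]
    have := mul_le_mul_of_nonneg_left h3 (abs_nonneg t)
    linarith
  have ha0 : 0 < 1 + t * ψ x := by linarith [(abs_le.mp ha).1]
  have hb0 : 0 < 1 + t * (ψ x + fderiv ℝ ψ x x) := by linarith [(abs_le.mp hb).1]
  obtain ⟨k, hk⟩ : ∃ k, Module.finrank ℝ E = k + 1 := ⟨_, (Nat.sub_add_cancel hd).symm⟩
  rw [det_fderiv_deform ψ t x hd ha0.ne', abs_of_pos (by positivity), ← Real.le_log_iff_exp_le
    (by positivity), Real.log_mul (by positivity) hb0.ne', Real.log_pow, radialDiv, hk]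
  simp only [Nat.add_sub_cancel]
  have la := mul_le_mul_of_nonneg_left (sub_le_log_one_add ha) (Nat.cast_nonneg (α := ℝ) k)
  have lb := sub_le_log_one_add hb
  have sa : ψ x ^ 2 ≤ B ^ 2 := sq_le_sq' (abs_le.mp h1).1 (abs_le.mp h1).2
  have sb : (ψ x + fderiv ℝ ψ x x) ^ 2 ≤ (2 * B) ^ 2 :=
    sq_le_sq' (abs_le.mp h3).1 (abs_le.mp h3).2
  have sa' : 0 ≤ (k : ℝ) * t ^ 2 * (B ^ 2 - ψ x ^ 2) :=
    mul_nonneg (by positivity) (by linarith)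
  have sb' : 0 ≤ t ^ 2 * ((2 * B) ^ 2 - (ψ x + fderiv ℝ ψ x x) ^ 2) :=
    mul_nonneg (by positivity) (by linarith)
  have : 0 ≤ t ^ 2 * B ^ 2 := by positivity
  push_cast
  nlinarith

lemma deform_bijective {ψ : E → ℝ} {L : NNReal} (hL : LipschitzWith L (radialField ψ)) {t : ℝ}
    (ht : |t| * L < 1) : Function.Bijective (deform ψ t) := by
  have hc : ‖t‖₊ * L < 1 := by
    rw [← NNReal.coe_lt_coe]; simpa using ht
  have happ : ApproximatesLinearOn (deform ψ t)
      ((ContinuousLinearEquiv.refl ℝ E : E ≃L[ℝ] E) : E →L[ℝ] E) Set.univ (‖t‖₊ * L) := by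
    intro x _ y _
    have : deform ψ t x - deform ψ t y -
        ((ContinuousLinearEquiv.refl ℝ E : E ≃L[ℝ] E) : E →L[ℝ] E) (x - y) =
        t • (radialField ψ x - radialField ψ y) := by
      simp [deform, smul_sub]; abel
    rw [this, norm_smul]
    push_cast
    rw [mul_assoc]
    exact mul_le_mul_of_nonneg_left (hL.norm_sub_le x y) (norm_nonneg t)
  have hcond : Subsingleton E ∨ ‖t‖₊ * L <
      ‖((ContinuousLinearEquiv.refl ℝ E).symm : E →L[ℝ] E)‖₊⁻¹ := by
    rcases subsingleton_or_nontrivial E with h | h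
    · exact Or.inl h
    · right
      have : ‖((ContinuousLinearEquiv.refl ℝ E).symm : E →L[ℝ] E)‖₊ = 1 := by
        ext; simp 
      rw [this]; simpa using hc
  exact ⟨Set.injOn_univ.mp (Set.injOn_iff_injective.mpr (happ.injective hcond)),
    happ.surjective hcond⟩

lemma integral_comp_deform {ψ : E → ℝ} (hψ : ContDiff ℝ 1 ψ) {t : ℝ}
    (hbij : Function.Bijective (deform ψ t)) (g : E → ℝ) :
    ∫ x, g x = ∫ x, |(deformDeriv ψ t x).det| * g (deform ψ t x) := by
  have := integral_image_eq_integral_abs_det_fderiv_smul volume MeasurableSet.univ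
    (fun x _ => (hasFDerivAt_deform hψ t x).hasFDerivWithinAt) hbij.1.injOn g
  simpa [Set.image_univ, hbij.2.range_eq] using this

lemma integrable_comp_deform {ψ : E → ℝ} (hψ : ContDiff ℝ 1 ψ) {t : ℝ}
    (hbij : Function.Bijective (deform ψ t)) {g : E → ℝ} (hg : Integrable g) :
    Integrable fun x => |(deformDeriv ψ t x).det| * g (deform ψ t x) := by
  have := integrableOn_image_iff_integrableOn_abs_det_fderiv_smul volume MeasurableSet.univ
    (fun x _ => (hasFDerivAt_deform hψ t x).hasFDerivWithinAt) hbij.1.injOn g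
  rw [Set.image_univ, hbij.2.range_eq, integrableOn_univ, integrableOn_univ] at this
  exact this.mp hg

/-- Second-order upper bound for the distance between two deformed points. -/
lemma norm_deform_sub_le {ψ : E → ℝ} {L : NNReal} (hL : LipschitzWith L (radialField ψ)) (t : ℝ)
    (x y : E) : ‖deform ψ t x - deform ψ t y‖ ≤
      ‖x - y‖ * Real.exp (t * stretch ψ x y + t ^ 2 * (L ^ 2 / 2)) := by
  rcases eq_or_ne x y with rfl | hxy
  · simp
  have hr : 0 < ‖x - y‖ := norm_pos_iff.mpr (sub_ne_zero.mpr hxy)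
  refine abs_le_of_sq_le_sq' ?_ (by positivity) |>.2
  have h1 : deform ψ t x - deform ψ t y = (x - y) + t • (radialField ψ x - radialField ψ y) := by
    simp only [deform, smul_sub]; abel
  have h2 : inner ℝ (x - y) (radialField ψ x - radialField ψ y) =
      stretch ψ x y * ‖x - y‖ ^ 2 := by
    rw [stretch, real_inner_comm]; field_simp
  have h3 : ‖radialField ψ x - radialField ψ y‖ ^ 2 ≤ (L * ‖x - y‖) ^ 2 := by
    gcongr; exact hL.norm_sub_le x y
  rw [h1, norm_add_sq_real, inner_smul_right, h2, norm_smul, mul_pow, mul_pow, ← Real.exp_nat_mul,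
    Real.norm_eq_abs, sq_abs]
  have h4 := Real.add_one_le_exp ((2 : ℕ) * (t * stretch ψ x y + t ^ 2 * (L ^ 2 / 2)))
  have h5 := mul_le_mul_of_nonneg_left h4 (sq_nonneg ‖x - y‖)
  have h6 := mul_le_mul_of_nonneg_left h3 (sq_nonneg t)
  push_cast at h5 ⊢
  nlinarith

/-! ### First variation of the Riesz energy -/

/-- The integrand `f(x) f(y) / ‖x - y‖ˢ` of the Riesz energy of `f`. -/
noncomputable def energyKernel (s : ℝ) (f : E → ℝ) (p : E × E) : ℝ :=
  f p.1 * (f p.2 / ‖p.1 - p.2‖ ^ s)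

/-- The density `f(x) ∫ f(y) / ‖x - y‖ˢ dy`, whose integral is the Riesz energy of `f`. -/
noncomputable def energyDensity (s : ℝ) (f : E → ℝ) (x : E) : ℝ :=
  (∫ y, f y / ‖x - y‖ ^ s) * f x

lemma energyKernel_swap (s : ℝ) (f : E → ℝ) (p : E × E) :
    energyKernel s f p.swap = energyKernel s f p := by
  simp only [energyKernel, Prod.fst_swap, Prod.snd_swap, norm_sub_rev p.2]
  ring

lemma integral_energyKernel_right (s : ℝ) (f : E → ℝ) (x : E) :
    ∫ y, energyKernel s f (x, y) = energyDensity s f x := by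
  simp only [energyKernel, energyDensity, integral_const_mul, mul_comm]

lemma integrable_energyKernel {s : ℝ} {f : E → ℝ} (hs0 : 0 < s) (hs : s < Module.finrank ℝ E)
    (hf : Continuous f) (hf0 : ∀ x, 0 ≤ f x) (hfi : Integrable f)
    (hw : Integrable (energyDensity s f)) :
    Integrable (energyKernel s f) (volume.prod volume) := by
  refine (integrable_prod_iff ?_).mpr ⟨Filter.Eventually.of_forall fun x => ?_, ?_⟩
  · have := hf.measurable
    unfold energyKernel
    exact Measurable.aestronglyMeasurable (by fun_prop)
  · exact (integrable_div_rpow hs0 hs hfi (.of_continuous hf) x).const_mul (f x)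
  · refine hw.congr (Filter.Eventually.of_forall fun x => ?_)
    rw [← integral_energyKernel_right]
    refine integral_congr_ae (Filter.Eventually.of_forall fun y => ?_)
    have h1 := hf0 x
    have h2 := hf0 y
    simp only [energyKernel]
    exact (Real.norm_of_nonneg (by positivity)).symm

lemma integral_fst_mul_energyKernel {s : ℝ} {f g : E → ℝ} {M : ℝ}
    (hm : Integrable (energyKernel s f) (volume.prod volume))
    (hg : Continuous g) (hM : ∀ x, |g x| ≤ M) :
    Integrable (fun p => g p.1 * energyKernel s f p) (volume.prod volume) ∧
      ∫ p, g p.1 * energyKernel s f p ∂(volume.prod volume) = ∫ x, g x * energyDensity s f x := by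
  have h : Integrable (fun p => g p.1 * energyKernel s f p) (volume.prod volume) :=
    hm.bdd_mul (hg.comp continuous_fst).aestronglyMeasurable
      (Filter.Eventually.of_forall fun p => hM p.1)
  refine ⟨h, ?_⟩
  rw [integral_prod _ h]
  simp only [integral_const_mul, integral_energyKernel_right]

lemma integral_snd_mul_energyKernel {s : ℝ} {f g : E → ℝ} {M : ℝ}
    (hm : Integrable (energyKernel s f) (volume.prod volume))
    (hg : Continuous g) (hM : ∀ x, |g x| ≤ M) :
    Integrable (fun p => g p.2 * energyKernel s f p) (volume.prod volume) ∧
      ∫ p, g p.2 * energyKernel s f p ∂(volume.prod volume) = ∫ x, g x * energyDensity s f x := by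
  obtain ⟨h1, h2⟩ := integral_fst_mul_energyKernel hm hg hM
  have h3 := h1.swap
  have h4 := integral_prod_swap (μ := (volume : Measure E)) (ν := (volume : Measure E))
    (fun p => g p.1 * energyKernel s f p)
  simp only [energyKernel_swap, Prod.fst_swap] at h4
  refine ⟨h3.congr (Filter.Eventually.of_forall fun p => ?_), h4.trans h2⟩
  simp [energyKernel_swap]

lemma continuous_deform {ψ : E → ℝ} (hψ : Continuous ψ) (t : ℝ) : Continuous (deform ψ t) := by
  unfold deform radialField
  fun_prop

lemma exists_bound_sub_comp_deform {u ψ : E → ℝ} (hu : Continuous u) (hψ : Continuous ψ)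
    (hc : HasCompactSupport ψ) (t : ℝ) : ∃ M, ∀ x, |u (deform ψ t x) - u x| ≤ M := by
  refine HasCompactSupport.exists_bound_of_continuous (f := fun x => u (deform ψ t x) - u x)
    (hc.mono fun x hx h => hx ?_) ((hu.comp (continuous_deform hψ t)).sub hu)
  simp [deform, radialField, h]

/-- Pointwise comparison of the pulled-back energy integrand with the original one, from
`1 + q ≤ exp q`. -/
lemma energyKernel_comp_deform_ge {s c t D : ℝ} (hs0 : 0 < s) {u ψ : E → ℝ} {L : NNReal}
    (hL : LipschitzWith L (radialField ψ)) (hinj : Function.Injective (deform ψ t))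
    (hJ : ∀ x, Real.exp (t * radialDiv ψ x - t ^ 2 * D) ≤ |(deformDeriv ψ t x).det|)
    (p : E × E) :
    (1 + (c * ((u (deform ψ t p.1) - u p.1) + (u (deform ψ t p.2) - u p.2))
      + t * (radialDiv ψ p.1 + radialDiv ψ p.2) - s * t * stretch ψ p.1 p.2
      - t ^ 2 * (2 * D + s * L ^ 2 / 2))) * energyKernel s (fun y => Real.exp (c * u y)) p ≤
    |(deformDeriv ψ t p.1).det| * (Real.exp (c * u (deform ψ t p.1)) *
      (|(deformDeriv ψ t p.2).det| * (Real.exp (c * u (deform ψ t p.2)) /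
        ‖deform ψ t p.1 - deform ψ t p.2‖ ^ s))) := by
  obtain ⟨x, y⟩ := p
  simp only [energyKernel]
  rcases eq_or_ne x y with rfl | hxy
  · simp [Real.zero_rpow hs0.ne']
  have hr : 0 < ‖x - y‖ := norm_pos_iff.mpr (sub_ne_zero.mpr hxy)
  have hr' : 0 < ‖deform ψ t x - deform ψ t y‖ :=
    norm_pos_iff.mpr (sub_ne_zero.mpr (hinj.ne hxy))
  set e := t * stretch ψ x y + t ^ 2 * (L ^ 2 / 2) with he
  have hdist : ‖deform ψ t x - deform ψ t y‖ ^ s ≤ ‖x - y‖ ^ s * Real.exp (s * e) := by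
    calc _ ≤ (‖x - y‖ * Real.exp e) ^ s := by
          gcongr; exact norm_deform_sub_le hL t x y
      _ = _ := by
          rw [Real.mul_rpow hr.le (Real.exp_pos _).le, ← Real.exp_mul, mul_comm e s]
  have hinv : Real.exp (-(s * e)) / ‖x - y‖ ^ s ≤ 1 / ‖deform ψ t x - deform ψ t y‖ ^ s := by
    rw [Real.exp_neg, inv_eq_one_div, div_div, mul_comm]
    exact one_div_le_one_div_of_le (by positivity) hdist
  have hpos : 0 < Real.exp (c * u x) * (Real.exp (c * u y) / ‖x - y‖ ^ s) := by positivity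
  have hexp := mul_le_mul_of_nonneg_right (Real.add_one_le_exp
    (c * ((u (deform ψ t x) - u x) + (u (deform ψ t y) - u y))
      + t * (radialDiv ψ x + radialDiv ψ y) - s * t * stretch ψ x y
      - t ^ 2 * (2 * D + s * L ^ 2 / 2))) hpos.le
  rw [add_comm 1]
  refine hexp.trans ?_
  calc _ = Real.exp (t * radialDiv ψ x - t ^ 2 * D) * (Real.exp (c * u (deform ψ t x)) *
        (Real.exp (t * radialDiv ψ y - t ^ 2 * D) * (Real.exp (c * u (deform ψ t y)) *
          (Real.exp (-(s * e)) / ‖x - y‖ ^ s)))) := by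
        simp only [mul_div_assoc', ← Real.exp_add]
        congr 2
        rw [he]; ring
    _ ≤ |(deformDeriv ψ t x).det| * (Real.exp (c * u (deform ψ t x)) *
        (|(deformDeriv ψ t y).det| * (Real.exp (c * u (deform ψ t y)) *
          (1 / ‖deform ψ t x - deform ψ t y‖ ^ s)))) := by
        gcongr
        · exact hJ x
        · exact hJ y
    _ = _ := by simp only [mul_one_div]

/-- First-variation inequality for the Riesz energy of `exp (c u)` under a compactly supported
radial deformation: the energy is invariant under the change of variables `deform ψ t`, so the
first-order change of its integrand cannot have positive mean. -/
theorem exists_first_variation_le {s c : ℝ} {u ψ : E → ℝ} (hs0 : 0 < s)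
    (hs : s < Module.finrank ℝ E) (hu : Continuous u)
    (hfi : Integrable fun y => Real.exp (c * u y))
    (hw : Integrable (energyDensity s fun y => Real.exp (c * u y)))
    (hψ : ContDiff ℝ 1 ψ) (hc : HasCompactSupport ψ) :
    ∃ t₀ > 0, ∃ K : ℝ, ∀ t, |t| ≤ t₀ →
      2 * c * (∫ x, (u (deform ψ t x) - u x) * energyDensity s (fun y => Real.exp (c * u y)) x) +
        t * (2 * (∫ x, radialDiv ψ x * energyDensity s (fun y => Real.exp (c * u y)) x) -
          s * ∫ p : E × E, stretch ψ p.1 p.2 * energyKernel s (fun y => Real.exp (c * u y)) p) ≤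
        K * t ^ 2 := by
  have hd : 1 ≤ Module.finrank ℝ E := by
    have : (0 : ℝ) < Module.finrank ℝ E := hs0.trans hs
    exact_mod_cast this
  obtain ⟨L, hL⟩ := exists_lipschitzWith_radialField hψ hc
  obtain ⟨B, hB0, hB⟩ := exists_bound_of_compactSupport hψ hc
  set f : E → ℝ := fun y => Real.exp (c * u y) with hf
  set w := energyDensity s f with hwdef
  have hfc : Continuous f := by fun_prop
  have hm := integrable_energyKernel hs0 hs hfc (fun x => (Real.exp_pos _).le) hfi hw
  set D : ℝ := (2 * Module.finrank ℝ E + 8) * B ^ 2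
  set K : ℝ := 2 * D + s * L ^ 2 / 2
  have hdivc : Continuous (radialDiv ψ) :=
    (continuous_const.mul hψ.continuous).add (continuous_fderiv_self hψ)
  have hdivb : ∀ x, |radialDiv ψ x| ≤ Module.finrank ℝ E * B + B := fun x => by
    refine (abs_add_le _ _).trans (add_le_add ?_ (hB x).2)
    rw [abs_mul, Nat.abs_cast]
    exact mul_le_mul_of_nonneg_left (hB x).1 (Nat.cast_nonneg _)
  -- The first bound makes the Jacobian estimate hold, the second makes `deform ψ t` bijective.
  refine ⟨min (1 / (4 * B)) (1 / (2 * (L + 1))), by positivity, K * ∫ x, w x, fun t ht => ?_⟩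
  have htB : |t| * B ≤ 1 / 4 := by
    have := (le_div_iff₀ (by positivity)).mp (ht.trans (min_le_left _ _))
    linarith
  have htL : |t| * L < 1 := by
    have := (le_div_iff₀ (by positivity)).mp (ht.trans (min_le_right _ _))
    nlinarith [abs_nonneg t]
  have hbij := deform_bijective hL htL
  obtain ⟨M, hM⟩ := exists_bound_sub_comp_deform hu hψ.continuous hc t
  have hpc : Continuous fun x => u (deform ψ t x) - u x :=
    (hu.comp (continuous_deform hψ.continuous t)).sub hu
  obtain ⟨i1, e1⟩ := integral_fst_mul_energyKernel hm hpc hM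
  obtain ⟨i2, e2⟩ := integral_snd_mul_energyKernel hm hpc hM
  obtain ⟨i3, e3⟩ := integral_fst_mul_energyKernel hm hdivc hdivb
  obtain ⟨i4, e4⟩ := integral_snd_mul_energyKernel hm hdivc hdivb
  have i5 : Integrable (fun p : E × E => stretch ψ p.1 p.2 * energyKernel s f p)
      (volume.prod volume) :=
    hm.bdd_mul (measurable_stretch hψ.continuous).aestronglyMeasurable
      (Filter.Eventually.of_forall fun p => abs_stretch_le hL p.1 p.2)
  have em : ∫ p, energyKernel s f p ∂(volume.prod volume) = ∫ x, w x := by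
    rw [integral_prod _ hm]
    simp only [integral_energyKernel_right, hwdef]
  -- The pulled-back integrand, first order in `t`.
  set G : E × E → ℝ := fun p =>
    (1 + (c * ((u (deform ψ t p.1) - u p.1) + (u (deform ψ t p.2) - u p.2))
      + t * (radialDiv ψ p.1 + radialDiv ψ p.2) - s * t * stretch ψ p.1 p.2
      - t ^ 2 * K)) * energyKernel s f p with hG
  have hsplit : G = fun p => (((((1 - t ^ 2 * K) * energyKernel s f p +
      c * ((u (deform ψ t p.1) - u p.1) * energyKernel s f p)) +
      c * ((u (deform ψ t p.2) - u p.2) * energyKernel s f p)) +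
      t * (radialDiv ψ p.1 * energyKernel s f p)) +
      t * (radialDiv ψ p.2 * energyKernel s f p)) -
      s * t * (stretch ψ p.1 p.2 * energyKernel s f p) := by
    funext p
    simp only [hG]; ring
  have j0 := hm.const_mul (1 - t ^ 2 * K)
  have j1 := j0.add (i1.const_mul c)
  have j2 := j1.add (i2.const_mul c)
  have j3 := j2.add (i3.const_mul t)
  have j4 := j3.add (i4.const_mul t)
  have j5 := i5.const_mul (s * t)
  have hGi : Integrable G (volume.prod volume) := by
    rw [hsplit]
    exact j4.sub j5
  have hGval : ∫ p, G p ∂(volume.prod volume) = (1 - t ^ 2 * K) * (∫ x, w x) +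
      2 * c * (∫ x, (u (deform ψ t x) - u x) * w x) + 2 * t * (∫ x, radialDiv ψ x * w x) -
      s * t * ∫ p : E × E, stretch ψ p.1 p.2 * energyKernel s f p := by
    rw [hsplit]
    erw [integral_sub j4 j5, integral_add j3 (i4.const_mul t), integral_add j2 (i3.const_mul t),
      integral_add j1 (i2.const_mul c), integral_add j0 (i1.const_mul c)]
    simp only [integral_const_mul, e1, e2, e3, e4, em]
    rw [← Measure.volume_eq_prod]
    ring
  have hle : ∫ p, G p ∂(volume.prod volume) ≤ ∫ x, w x := by
    rw [integral_prod _ hGi, integral_comp_deform hψ hbij w]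
    refine integral_mono_ae hGi.integral_prod_left (integrable_comp_deform hψ hbij hw) ?_
    filter_upwards [hGi.prod_right_ae] with x hx
    have hint := integrable_div_rpow hs0 hs hfi (.of_continuous hfc) (deform ψ t x)
    have hcv := integral_comp_deform hψ hbij fun y => f y / ‖deform ψ t x - y‖ ^ s
    have hci := integrable_comp_deform hψ hbij hint
    calc ∫ y, G (x, y) ≤ ∫ y, |(deformDeriv ψ t x).det| * (f (deform ψ t x) *
          (|(deformDeriv ψ t y).det| *
            (f (deform ψ t y) / ‖deform ψ t x - deform ψ t y‖ ^ s))) :=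
          integral_mono hx ((hci.const_mul _).const_mul _) fun y =>
            energyKernel_comp_deform_ge hs0 hL hbij.1 (fun x => exp_le_abs_det hd hB htB x) (x, y)
      _ = |(deformDeriv ψ t x).det| * w (deform ψ t x) := by
          rw [integral_const_mul, integral_const_mul, ← hcv, hwdef, energyDensity]
          ring
  rw [hGval] at hle
  linarith

/-! ### Displacement of the logarithmic potential -/

/-- The relative change of `‖x - z‖` when only `x` is moved by `deform ψ t`; it is `0` for
`x = z`. -/
noncomputable def relChange (ψ : E → ℝ) (t : ℝ) (x z : E) : ℝ :=
  (‖deform ψ t x - z‖ - ‖x - z‖) / ‖x - z‖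

/-- The derivative of `relChange ψ t x z` at `t = 0`. -/
noncomputable def oneSidedRate (ψ : E → ℝ) (x z : E) : ℝ :=
  inner ℝ (radialField ψ x) (x - z) / ‖x - z‖ ^ 2

lemma stretch_eq_add (ψ : E → ℝ) (x z : E) :
    stretch ψ x z = oneSidedRate ψ x z + oneSidedRate ψ z x := by
  unfold stretch oneSidedRate
  rw [norm_sub_rev z x, ← add_div, inner_sub_left, ← neg_sub x z, inner_neg_right]
  ring

lemma abs_relChange_le (ψ : E → ℝ) (t : ℝ) (x z : E) :
    |relChange ψ t x z| ≤ |t| * (‖radialField ψ x‖ / ‖x - z‖) := by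
  unfold relChange
  rw [abs_div, abs_norm, mul_div_assoc']
  gcongr
  refine (abs_norm_sub_norm_le _ _).trans ?_
  rw [← Real.norm_eq_abs t, ← norm_smul]
  simp [deform]

lemma tendsto_relChange_div (ψ : E → ℝ) {x z : E} (hxz : x ≠ z) :
    Tendsto (fun t => t⁻¹ * relChange ψ t x z) (𝓝[>] 0) (𝓝 (oneSidedRate ψ x z)) := by
  have h0 : x - z ≠ 0 := sub_ne_zero.mpr hxz
  have hr : 0 < ‖x - z‖ := norm_pos_iff.mpr h0
  have h1 : HasDerivAt (fun t : ℝ => (x - z) + t • radialField ψ x) (radialField ψ x) 0 := by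
    simpa using ((hasDerivAt_id (0 : ℝ)).smul_const (radialField ψ x)).const_add (x - z)
  have h2 := (h1.norm_sq.sqrt (by simpa using h0)).tendsto_slope_zero_right.div_const ‖x - z‖
  refine (h2.congr fun t => ?_).trans (le_of_eq ?_)
  · simp only [Real.sqrt_sq (norm_nonneg _), zero_add, zero_smul, add_zero, smul_eq_mul]
    rw [relChange, deform, sub_add_eq_add_sub]
    ring
  · congr 1
    simp only [zero_smul, add_zero, Real.sqrt_sq (norm_nonneg _)]
    rw [oneSidedRate, real_inner_comm]
    field_simp

section Potential

variable {w : E → ℝ} {ψ : E → ℝ}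

lemma ae_ne_left [Nontrivial E] (x : E) : ∀ᵐ y : E, x ≠ y := by
  have : ({x} : Set E)ᶜ ∈ ae (volume : Measure E) := compl_mem_ae_iff.mpr (measure_singleton x)
  filter_upwards [this] with y hy h
  exact hy h.symm

lemma ae_fst_ne_snd [Nontrivial E] :
    ∀ᵐ p : E × E ∂(volume.prod volume), p.1 ≠ p.2 := by
  have hs : MeasurableSet {p : E × E | p.1 = p.2} := isClosed_diagonal.measurableSet
  have h0 : (volume.prod volume) {p : E × E | p.1 = p.2} = 0 := by
    refine (Measure.measure_prod_null hs).mpr (Eventually.of_forall fun x => ?_)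
    have : Prod.mk x ⁻¹' {p : E × E | p.1 = p.2} = {x} := by ext y; simp [eq_comm]
    simp [this]
  simpa [ae_iff] using h0

lemma measurable_relChange (hψ : Continuous ψ) (t : ℝ) :
    Measurable fun p : E × E => relChange ψ t p.1 p.2 := by
  have := (continuous_deform hψ t).measurable
  unfold relChange
  fun_prop

lemma integrable_relChange_mul (hd : 2 ≤ Module.finrank ℝ E) (hw : Integrable w)
    (hb : LocallyBounded w) (hψ : Continuous ψ) (t : ℝ) (x : E) :
    Integrable fun z => relChange ψ t x z * w z := by
  have h1 : (1 : ℝ) < Module.finrank ℝ E := by exact_mod_cast hd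
  refine ((integrable_div_rpow one_pos h1 hw hb x).abs.const_mul
    (|t| * ‖radialField ψ x‖)).mono'
    (((measurable_relChange hψ t).comp measurable_prodMk_left).aestronglyMeasurable.mul
      hw.aestronglyMeasurable) (Eventually.of_forall fun z => ?_)
  rw [Real.norm_eq_abs, abs_mul]
  calc _ ≤ |t| * (‖radialField ψ x‖ / ‖x - z‖) * |w z| := by
        gcongr; exact abs_relChange_le ψ t x z
    _ = _ := by
        rw [Real.rpow_one, abs_div, abs_norm]; ring

/-- A logarithmic potential decreases under a displacement by at most the mean relative change of
the distances, because `log a ≤ a - 1`. -/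
lemma neg_integral_relChange_le {u : E → ℝ} {b C : ℝ} (hd : 2 ≤ Module.finrank ℝ E)
    (hb0 : 0 ≤ b) (hw0 : ∀ x, 0 ≤ w x) (hw : Integrable w) (hb : LocallyBounded w)
    (hψ : Continuous ψ)
    (hu : ∀ x, u x = b * (∫ y, Real.log ((‖y‖ + 1) / ‖x - y‖) * w y) + C) (t : ℝ) (x : E) :
    -(b * ∫ z, relChange ψ t x z * w z) ≤ u (deform ψ t x) - u x := by
  have : Nontrivial E := Module.nontrivial_of_finrank_pos (R := ℝ) (by omega)
  have i1 := integrable_log_kernel_mul hd hw hb x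
  have i2 := integrable_log_kernel_mul hd hw hb (deform ψ t x)
  rw [hu, hu, add_sub_add_right_eq_sub, ← mul_sub, ← integral_sub i2 i1, ← mul_neg,
    ← integral_neg]
  refine mul_le_mul_of_nonneg_left (integral_mono_ae
    (integrable_relChange_mul hd hw hb hψ t x).neg (i2.sub i1) ?_) hb0
  filter_upwards [ae_ne_left x, ae_ne_left (deform ψ t x)] with y h1 h2
  have r1 : 0 < ‖x - y‖ := norm_pos_iff.mpr (sub_ne_zero.mpr h1)
  have r2 : 0 < ‖deform ψ t x - y‖ := norm_pos_iff.mpr (sub_ne_zero.mpr h2)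
  have ry : 0 < ‖y‖ + 1 := by positivity
  have hlog := Real.log_le_sub_one_of_pos (div_pos r2 r1)
  rw [Real.log_div r2.ne' r1.ne'] at hlog
  have hrel : relChange ψ t x y = ‖deform ψ t x - y‖ / ‖x - y‖ - 1 := by
    rw [relChange, sub_div, div_self r1.ne']
  rw [Real.log_div ry.ne' r1.ne', Real.log_div ry.ne' r2.ne', hrel, ← sub_mul, ← neg_mul]
  exact mul_le_mul_of_nonneg_right (by linarith) (hw0 y)

lemma integrable_field_div_mul (hd : 2 ≤ Module.finrank ℝ E) (hw : Integrable w)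
    (hb : LocallyBounded w) (hw0 : ∀ x, 0 ≤ w x) (hψ : Continuous ψ) (hc : HasCompactSupport ψ) :
    Integrable (fun p : E × E => ‖radialField ψ p.1‖ / ‖p.1 - p.2‖ * (w p.1 * w p.2))
      (volume.prod volume) := by
  have h1 : (1 : ℝ) < Module.finrank ℝ E := by exact_mod_cast hd
  have hXc : Continuous (radialField ψ) := hψ.smul continuous_id
  have hmeas : AEStronglyMeasurable
      (fun p : E × E => ‖radialField ψ p.1‖ / ‖p.1 - p.2‖ * (w p.1 * w p.2))
      (volume.prod volume) := by
    have := hXc.measurable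
    exact AEStronglyMeasurable.mul (Measurable.aestronglyMeasurable (by fun_prop))
      (hw.mul_prod hw).aestronglyMeasurable
  refine (integrable_prod_iff hmeas).mpr ⟨Eventually.of_forall fun x => ?_, ?_⟩
  · refine ((integrable_div_rpow one_pos h1 hw hb x).const_mul
      (‖radialField ψ x‖ * w x)).congr (Eventually.of_forall fun y => ?_)
    simp only [Real.rpow_one]
    ring
  · obtain ⟨R, hR⟩ := hc.isCompact.isBounded.subset_closedBall (0 : E)
    obtain ⟨A, hA⟩ := locallyBounded_integral_div_rpow one_pos h1 hw hb (max R 0)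
    obtain ⟨B, hB⟩ := (hc.smul_right (f' := fun x : E => x)).exists_bound_of_continuous hXc
    have hval : ∀ x, ∫ y, ‖‖radialField ψ x‖ / ‖x - y‖ * (w x * w y)‖ =
        ‖radialField ψ x‖ * (∫ y, w y / ‖x - y‖ ^ (1 : ℝ)) * w x := fun x => by
      rw [mul_right_comm, ← integral_const_mul]
      refine integral_congr_ae (Eventually.of_forall fun y => ?_)
      have := hw0 x
      have := hw0 y
      simp only [Real.rpow_one]
      rw [Real.norm_of_nonneg (by positivity)]
      ring
    simp only [hval]
    refine (hw.const_mul (B * A)).mono' ?_ (Eventually.of_forall fun x => ?_)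
    · simpa only [hval] using hmeas.norm.integral_prod_right'
    have hB0 : 0 ≤ B := (norm_nonneg _).trans (hB 0)
    rw [norm_mul, norm_mul, norm_norm, Real.norm_of_nonneg (hw0 x)]
    refine mul_le_mul_of_nonneg_right ?_ (hw0 x)
    by_cases hx : x ∈ tsupport ψ
    · exact mul_le_mul (hB x) (hA x ((by simpa using hR hx : ‖x‖ ≤ R).trans (le_max_left _ _)))
        (norm_nonneg _) hB0
    · have hA0 : 0 ≤ A := (abs_nonneg _).trans (hA 0 (by simp))
      have : radialField ψ x = 0 := by
        rw [radialField, image_eq_zero_of_notMem_tsupport hx, zero_smul]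
      rw [this, norm_zero, zero_mul]
      exact mul_nonneg hB0 hA0

/-- The one-sided rate integrates to half of the symmetric one. -/
lemma integral_oneSidedRate (hd : 2 ≤ Module.finrank ℝ E) (hw : Integrable w)
    (hb : LocallyBounded w) (hw0 : ∀ x, 0 ≤ w x) (hψ : Continuous ψ) (hc : HasCompactSupport ψ) :
    2 * ∫ p : E × E, oneSidedRate ψ p.1 p.2 * (w p.1 * w p.2) =
      ∫ p : E × E, stretch ψ p.1 p.2 * (w p.1 * w p.2) := by
  have hi : Integrable (fun p : E × E => oneSidedRate ψ p.1 p.2 * (w p.1 * w p.2))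
      (volume.prod volume) := by
    refine (integrable_field_div_mul hd hw hb hw0 hψ hc).mono'
      (AEStronglyMeasurable.mul (Measurable.aestronglyMeasurable ?_)
        (hw.mul_prod hw).aestronglyMeasurable) (Eventually.of_forall fun p => ?_)
    · unfold oneSidedRate radialField
      exact Measurable.div (Continuous.measurable (by fun_prop))
        (Continuous.measurable (by fun_prop))
    · have h1 := hw0 p.1
      have h2 := hw0 p.2
      rw [Real.norm_eq_abs, abs_mul, abs_of_nonneg (mul_nonneg h1 h2)]
      refine mul_le_mul_of_nonneg_right ?_ (mul_nonneg h1 h2)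
      rw [oneSidedRate, abs_div, abs_of_nonneg (sq_nonneg ‖p.1 - p.2‖)]
      rcases (norm_nonneg (p.1 - p.2)).eq_or_lt with h | h
      · simp [← h]
      · rw [div_le_div_iff₀ (by positivity) h]
        have := abs_real_inner_le_norm (radialField ψ p.1) (p.1 - p.2)
        nlinarith
  have hswap := integral_prod_swap (μ := (volume : Measure E)) (ν := (volume : Measure E))
    (fun p => oneSidedRate ψ p.1 p.2 * (w p.1 * w p.2))
  rw [← Measure.volume_eq_prod] at hi hswap
  have hsum := integral_add hi hi.swap
  simp only [Function.comp_apply] at hsum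
  rw [hswap] at hsum
  rw [two_mul, ← hsum]
  refine integral_congr_ae (Eventually.of_forall fun p => ?_)
  simp only [Prod.fst_swap, Prod.snd_swap, stretch_eq_add]
  ring

/-- Difference quotients of the interaction converge along the deformation. The dominating function
`‖X x‖ / ‖x - z‖ * w x * w z` is integrable because `X` has compact support and the dimension is
at least two. -/
lemma tendsto_integral_relChange (hd : 2 ≤ Module.finrank ℝ E) (hw : Integrable w)
    (hb : LocallyBounded w) (hw0 : ∀ x, 0 ≤ w x) (hψ : Continuous ψ) (hc : HasCompactSupport ψ) :
    Tendsto (fun t => ∫ p : E × E, t⁻¹ * relChange ψ t p.1 p.2 * (w p.1 * w p.2)) (𝓝[>] 0)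
      (𝓝 (∫ p : E × E, oneSidedRate ψ p.1 p.2 * (w p.1 * w p.2))) := by
  have : Nontrivial E := Module.nontrivial_of_finrank_pos (R := ℝ) (by omega)
  refine tendsto_integral_filter_of_dominated_convergence
    (fun p : E × E => ‖radialField ψ p.1‖ / ‖p.1 - p.2‖ * (w p.1 * w p.2)) ?_ ?_
    (integrable_field_div_mul hd hw hb hw0 hψ hc) ?_
  · refine Eventually.of_forall fun t => AEStronglyMeasurable.mul
      ((measurable_relChange hψ t).const_mul _).aestronglyMeasurable
      (hw.mul_prod hw).aestronglyMeasurable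
  · filter_upwards [self_mem_nhdsWithin] with t ht
    have ht : 0 < t := ht
    refine Eventually.of_forall fun p => ?_
    have h12 := mul_nonneg (hw0 p.1) (hw0 p.2)
    rw [norm_mul, Real.norm_of_nonneg h12, norm_mul, Real.norm_of_nonneg (inv_pos.mpr ht).le]
    refine mul_le_mul_of_nonneg_right ?_ h12
    rw [inv_mul_le_iff₀ ht]
    simpa [abs_of_pos ht] using abs_relChange_le ψ t p.1 p.2
  · filter_upwards [ae_fst_ne_snd (E := E)] with p hp
    exact (tendsto_relChange_div ψ hp).mul_const _

end Potential

/-! ### The Pohozaev identity for cutoff fields -/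

section Identity

variable {s c b C : ℝ} {u : E → ℝ}

/-- Half of the Pohozaev identity for a compactly supported radial field; the reverse inequality
comes from replacing `ψ` by `-ψ`. -/
theorem pohozaev_le (hd : 2 ≤ Module.finrank ℝ E) (hs0 : 0 < s) (hs : s < Module.finrank ℝ E)
    (hc0 : 0 ≤ c) (hb0 : 0 ≤ b) (hu : Continuous u)
    (hfi : Integrable fun y => Real.exp (c * u y)) {w : E → ℝ}
    (hwdef : w = energyDensity s fun y => Real.exp (c * u y)) (hw : Integrable w)
    (hsol : ∀ x, u x = b * (∫ y, Real.log ((‖y‖ + 1) / ‖x - y‖) * w y) + C)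
    {ψ : E → ℝ} (hψ : ContDiff ℝ 1 ψ) (hc : HasCompactSupport ψ) :
    2 * (∫ x, radialDiv ψ x * w x) -
        s * (∫ p : E × E, stretch ψ p.1 p.2 * energyKernel s (fun y => Real.exp (c * u y)) p) -
        c * b * (∫ p : E × E, stretch ψ p.1 p.2 * (w p.1 * w p.2)) ≤ 0 := by
  have hfc : Continuous fun y => Real.exp (c * u y) := by fun_prop
  have hw0 : ∀ x, 0 ≤ w x := fun x => by
    rw [hwdef]
    exact mul_nonneg (integral_nonneg fun y => by positivity) (Real.exp_pos _).le
  have hlb : LocallyBounded w := by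
    rw [hwdef]
    exact (locallyBounded_integral_div_rpow hs0 hs hfi (.of_continuous hfc)).mul
      (.of_continuous hfc)
  obtain ⟨t₀, ht₀, K, hK⟩ := exists_first_variation_le hs0 hs hu hfi (hwdef ▸ hw) hψ hc
  rw [← hwdef] at hK
  set Λ := 2 * (∫ x, radialDiv ψ x * w x) -
    s * (∫ p : E × E, stretch ψ p.1 p.2 * energyKernel s (fun y => Real.exp (c * u y)) p)
  have hlim := ((tendsto_integral_relChange hd hw hlb hw0 hψ.continuous hc).const_mul
    (2 * c * b)).const_sub Λ
  have hK0 : Tendsto (fun t : ℝ => K * t) (𝓝[>] 0) (𝓝 0) := by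
    have : Tendsto (fun t : ℝ => K * t) (𝓝 0) (𝓝 (K * 0)) :=
      (continuous_const.mul continuous_id).tendsto 0
    simpa using this.mono_left nhdsWithin_le_nhds
  have key := le_of_tendsto_of_tendsto hlim hK0 ?_
  · rw [← integral_oneSidedRate hd hw hlb hw0 hψ.continuous hc]
    linarith
  filter_upwards [Ioc_mem_nhdsGT ht₀] with t ht
  have htpos : 0 < t := ht.1
  have h1 := hK t (by rw [abs_of_pos htpos]; exact ht.2)
  have hdi : Integrable (fun p : E × E => relChange ψ t p.1 p.2 * (w p.1 * w p.2))
      (volume.prod volume) := by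
    refine ((integrable_field_div_mul hd hw hlb hw0 hψ.continuous hc).const_mul |t|).mono'
      (AEStronglyMeasurable.mul (measurable_relChange hψ.continuous t).aestronglyMeasurable
        (hw.mul_prod hw).aestronglyMeasurable) (Eventually.of_forall fun p => ?_)
    have h12 := mul_nonneg (hw0 p.1) (hw0 p.2)
    rw [norm_mul, Real.norm_of_nonneg h12, ← mul_assoc |t|]
    exact mul_le_mul_of_nonneg_right (abs_relChange_le ψ t p.1 p.2) h12
  have h2 : -(b * ∫ p : E × E, relChange ψ t p.1 p.2 * (w p.1 * w p.2)) ≤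
      ∫ x, (u (deform ψ t x) - u x) * w x := by
    obtain ⟨M, hM⟩ := exists_bound_sub_comp_deform hu hψ.continuous hc t
    have hfub : b * ∫ p : E × E, relChange ψ t p.1 p.2 * (w p.1 * w p.2) =
        ∫ x, b * (∫ z, relChange ψ t x z * w z) * w x := by
      rw [Measure.volume_eq_prod, integral_prod _ hdi, ← integral_const_mul]
      refine integral_congr_ae (Eventually.of_forall fun x => ?_)
      simp only
      rw [mul_assoc, ← integral_mul_const]
      congr 2
      funext z
      ring
    have hint : Integrable fun x => b * (∫ z, relChange ψ t x z * w z) * w x := by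
      refine (hdi.integral_prod_left.const_mul b).congr (Eventually.of_forall fun x => ?_)
      simp only
      rw [mul_assoc, ← integral_mul_const]
      congr 2
      funext z
      ring
    rw [hfub, ← integral_neg]
    refine integral_mono hint.neg (hw.bdd_mul
      ((hu.comp (continuous_deform hψ.continuous t)).sub hu).aestronglyMeasurable
      (Eventually.of_forall hM)) fun x => ?_
    simp only
    rw [← neg_mul]
    exact mul_le_mul_of_nonneg_right
      (neg_integral_relChange_le hd hb0 hw0 hw hlb hψ.continuous hsol t x) (hw0 x)
  have h3 : ∫ p : E × E, t⁻¹ * relChange ψ t p.1 p.2 * (w p.1 * w p.2) =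
      t⁻¹ * ∫ p : E × E, relChange ψ t p.1 p.2 * (w p.1 * w p.2) := by
    rw [← integral_const_mul]
    simp only [mul_assoc]
  rw [h3]
  have h4 := mul_le_mul_of_nonneg_left h2 (by positivity : 0 ≤ 2 * c)
  refine le_of_mul_le_mul_left ?_ htpos
  have h5 : t * (Λ - 2 * c * b * (t⁻¹ * ∫ p : E × E, relChange ψ t p.1 p.2 * (w p.1 * w p.2))) =
      t * Λ - 2 * c * b * ∫ p : E × E, relChange ψ t p.1 p.2 * (w p.1 * w p.2) := by
    field_simp
  rw [h5]
  linarith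

/-- The Pohozaev identity for a compactly supported radial field. -/
theorem pohozaev_eq (hd : 2 ≤ Module.finrank ℝ E) (hs0 : 0 < s) (hs : s < Module.finrank ℝ E)
    (hc0 : 0 ≤ c) (hb0 : 0 ≤ b) (hu : Continuous u)
    (hfi : Integrable fun y => Real.exp (c * u y)) {w : E → ℝ}
    (hwdef : w = energyDensity s fun y => Real.exp (c * u y)) (hw : Integrable w)
    (hsol : ∀ x, u x = b * (∫ y, Real.log ((‖y‖ + 1) / ‖x - y‖) * w y) + C)
    {ψ : E → ℝ} (hψ : ContDiff ℝ 1 ψ) (hc : HasCompactSupport ψ) :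
    2 * (∫ x, radialDiv ψ x * w x) -
        s * (∫ p : E × E, stretch ψ p.1 p.2 * energyKernel s (fun y => Real.exp (c * u y)) p) -
        c * b * (∫ p : E × E, stretch ψ p.1 p.2 * (w p.1 * w p.2)) = 0 := by
  have h1 := pohozaev_le hd hs0 hs hc0 hb0 hu hfi hwdef hw hsol hψ hc
  have h2 := pohozaev_le hd hs0 hs hc0 hb0 hu hfi hwdef hw hsol hψ.neg hc.neg
  have e1 : ∀ x, radialDiv (-ψ) x = -radialDiv ψ x := fun x => by
    simp only [radialDiv, fderiv_neg, Pi.neg_apply, neg_apply]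
    ring
  have e2 : ∀ x y, stretch (-ψ) x y = -stretch ψ x y := fun x y => by
    have : radialField (-ψ) x - radialField (-ψ) y = -(radialField ψ x - radialField ψ y) := by
      simp only [radialField, Pi.neg_apply, neg_smul]; abel
    rw [stretch, this, inner_neg_left, neg_div, stretch]
  change 2 * (∫ x, radialDiv (-ψ) x * w x) - s * (∫ p : E × E, stretch (-ψ) p.1 p.2 * _) -
    c * b * (∫ p : E × E, stretch (-ψ) p.1 p.2 * _) ≤ 0 at h2
  simp only [e1, e2, neg_mul, integral_neg] at h2
  linarith

end Identity

/-! ### Dilation of the cutoff and the total mass -/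

section Scaling

variable {φ : E → ℝ}

lemma radialField_comp_smul (r : ℝ) (x : E) :
    r • radialField (fun x => φ (r • x)) x = radialField φ (r • x) := by
  simp only [radialField, smul_smul, mul_comm]

/-- The rate `stretch` is invariant under dilating the cutoff, so dilated fields share a Lipschitz
constant. -/
lemma stretch_comp_smul {r : ℝ} (hr : r ≠ 0) (x y : E) :
    stretch (fun x => φ (r • x)) x y = stretch φ (r • x) (r • y) := by
  rw [stretch, stretch, ← radialField_comp_smul r x, ← radialField_comp_smul r y, ← smul_sub,
    ← smul_sub, inner_smul_left, inner_smul_right, norm_smul, mul_pow, Real.norm_eq_abs, sq_abs]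
  simp only [conj_trivial]
  rw [← mul_assoc, ← sq, mul_div_mul_left _ _ (pow_ne_zero 2 hr)]

lemma radialDiv_comp_smul (r : ℝ) (x : E) :
    radialDiv (fun x => φ (r • x)) x = radialDiv φ (r • x) := by
  simp only [radialDiv, fderiv_comp_smul, smul_apply, map_smul]

end Scaling

/-- The Pohozaev identity for the field `x ↦ x` itself, as the limit along dilated cutoffs. For
`c = (2d - s) / 2` it says that the total mass `∫ w` is `0` or `2 / b`. -/
theorem mass_identity {s c b C : ℝ} {u : E → ℝ} (hd : 2 ≤ Module.finrank ℝ E) (hs0 : 0 < s)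
    (hs : s < Module.finrank ℝ E) (hc0 : 0 ≤ c) (hb0 : 0 ≤ b) (hu : Continuous u)
    (hfi : Integrable fun y => Real.exp (c * u y)) {w : E → ℝ}
    (hwdef : w = energyDensity s fun y => Real.exp (c * u y)) (hw : Integrable w)
    (hsol : ∀ x, u x = b * (∫ y, Real.log ((‖y‖ + 1) / ‖x - y‖) * w y) + C) :
    2 * (Module.finrank ℝ E * ∫ x, w x) - s * (∫ x, w x) -
      c * b * ((∫ x, w x) * ∫ x, w x) = 0 := by
  have : Nontrivial E := Module.nontrivial_of_finrank_pos (R := ℝ) (by omega)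
  have hfc : Continuous fun y => Real.exp (c * u y) := by fun_prop
  have hm := integrable_energyKernel hs0 hs hfc (fun x => (Real.exp_pos _).le) hfi (hwdef ▸ hw)
  set m := energyKernel s fun y => Real.exp (c * u y) with hmdef
  have hmint : ∫ p, m p = ∫ x, w x := by
    rw [Measure.volume_eq_prod, integral_prod _ hm, hwdef]
    simp only [hmdef, integral_energyKernel_right]
  let f : ContDiffBump (0 : E) := ⟨1, 2, one_pos, one_lt_two⟩
  set φ : E → ℝ := fun x => f x
  have hφd : ContDiff ℝ 1 φ := f.contDiff
  have hφc : HasCompactSupport φ := f.hasCompactSupport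
  obtain ⟨L, hL⟩ := exists_lipschitzWith_radialField hφd hφc
  obtain ⟨B, hB0, hB⟩ := exists_bound_of_compactSupport hφd hφc
  set r : ℕ → ℝ := fun k => 1 / ((k : ℝ) + 1) with hr
  have hrpos : ∀ k, r k ≠ 0 := fun k => by simp only [hr]; positivity
  have hrlim : ∀ x : E, Tendsto (fun k => r k • x) atTop (𝓝 0) := fun x => by
    simpa [hr] using (tendsto_one_div_add_atTop_nhds_zero_nat (𝕜 := ℝ)).smul_const x
  have hone : ∀ x : E, ∀ᶠ k in atTop, φ (r k • x) = 1 := fun x =>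
    (hrlim x).eventually f.eventuallyEq_one
  have hident : ∀ k, 2 * (∫ x, radialDiv φ (r k • x) * w x) -
      s * (∫ p : E × E, stretch φ (r k • p.1) (r k • p.2) * m p) -
      c * b * (∫ p : E × E, stretch φ (r k • p.1) (r k • p.2) * (w p.1 * w p.2)) = 0 := fun k => by
    have := pohozaev_eq hd hs0 hs hc0 hb0 hu hfi hwdef hw hsol (ψ := fun x => φ (r k • x))
      (hφd.comp (contDiff_const_smul (r k))) (hφc.comp_smul (hrpos k))
    simpa only [radialDiv_comp_smul, stretch_comp_smul (hrpos k)] using this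
  have hdivc : Continuous (radialDiv φ) :=
    (continuous_const.mul hφd.continuous).add (continuous_fderiv_self hφd)
  have l1 : Tendsto (fun k => ∫ x, radialDiv φ (r k • x) * w x) atTop
      (𝓝 (∫ x, (Module.finrank ℝ E : ℝ) * w x)) := by
    refine tendsto_integral_of_dominated_convergence
      (fun x => (Module.finrank ℝ E * B + B) * |w x|) (fun k => ?_) (hw.abs.const_mul _)
      (fun k => Eventually.of_forall fun x => ?_) (Eventually.of_forall fun x => ?_)
    · exact (hdivc.comp (continuous_const_smul (r k))).aestronglyMeasurable.mul
        hw.aestronglyMeasurable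
    · rw [norm_mul, Real.norm_eq_abs, Real.norm_eq_abs]
      refine mul_le_mul_of_nonneg_right ((abs_add_le _ _).trans (add_le_add ?_ (hB _).2))
        (abs_nonneg _)
      rw [abs_mul, Nat.abs_cast]
      exact mul_le_mul_of_nonneg_left (hB _).1 (Nat.cast_nonneg _)
    · have h0 : radialDiv φ 0 = Module.finrank ℝ E := by
        have : φ 0 = 1 := f.eventuallyEq_one.self_of_nhds
        simp [radialDiv, this]
      have := ((hdivc.tendsto 0).comp (hrlim x)).mul_const (w x)
      rwa [h0] at this
  -- Off the diagonal the rate is eventually `1`, and it never exceeds the Lipschitz constant.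
  have l2 : ∀ g : E × E → ℝ, Integrable g (volume.prod volume) →
      Tendsto (fun k => ∫ p : E × E, stretch φ (r k • p.1) (r k • p.2) * g p) atTop
        (𝓝 (∫ p, g p)) := fun g hg => by
    refine tendsto_integral_of_dominated_convergence (fun p => L * |g p|) (fun k => ?_)
      (hg.abs.const_mul _) (fun k => Eventually.of_forall fun p => ?_) ?_
    · have := (measurable_stretch hφd.continuous).comp
        ((measurable_fst.const_smul (r k)).prodMk (measurable_snd.const_smul (r k)) :
          Measurable fun p : E × E => (r k • p.1, r k • p.2))
      exact this.aestronglyMeasurable.mul hg.aestronglyMeasurable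
    · rw [norm_mul, Real.norm_eq_abs, Real.norm_eq_abs]
      exact mul_le_mul_of_nonneg_right (abs_stretch_le hL _ _) (abs_nonneg _)
    · filter_upwards [ae_fst_ne_snd (E := E)] with p hp
      refine tendsto_const_nhds.congr' ?_
      filter_upwards [hone p.1, hone p.2] with k h1 h2
      have h0 : r k • p.1 - r k • p.2 ≠ 0 := by
        rw [← smul_sub]
        exact smul_ne_zero (hrpos k) (sub_ne_zero.mpr hp)
      rw [stretch, radialField, radialField, h1, h2, one_smul, one_smul,
        real_inner_self_eq_norm_sq, div_self (by simpa using h0), one_mul]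
  have hlim := ((l1.const_mul 2).sub ((l2 m hm).const_mul s)).sub
    ((l2 _ (hw.mul_prod hw)).const_mul (c * b))
  rw [hmint, integral_const_mul, Measure.volume_eq_prod,
    integral_prod_mul (μ := (volume : Measure E)) (ν := (volume : Measure E)) w w] at hlim
  refine tendsto_nhds_unique hlim ?_
  simp only [← Measure.volume_eq_prod, hident]
  exact tendsto_const_nhds

lemma integral_energyDensity_pos [Nontrivial E] {s : ℝ} {f : E → ℝ} (hs0 : 0 < s)
    (hs : s < Module.finrank ℝ E) (hf : Continuous f) (hf0 : ∀ x, 0 < f x) (hfi : Integrable f)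
    (hw : Integrable (energyDensity s f)) : 0 < ∫ x, energyDensity s f x := by
  have hpos : ∀ x, 0 < energyDensity s f x := fun x => by
    refine mul_pos ?_ (hf0 x)
    have hnn : ∀ y, 0 ≤ f y / ‖x - y‖ ^ s := fun y => by
      have := hf0 y
      positivity
    refine (integral_nonneg hnn).lt_of_ne' fun h => ?_
    have h0 := (integral_eq_zero_iff_of_nonneg hnn
      (integrable_div_rpow hs0 hs hfi (.of_continuous hf) x)).mp h
    obtain ⟨y, hy, hxy⟩ := (h0.and (ae_ne_left x)).exists
    have hr : 0 < ‖x - y‖ := norm_pos_iff.mpr (sub_ne_zero.mpr hxy)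
    exact (div_pos (hf0 y) (Real.rpow_pos_of_pos hr s)).ne' hy
  refine (integral_nonneg fun x => (hpos x).le).lt_of_ne' fun h => ?_
  obtain ⟨x, hx⟩ := ((integral_eq_zero_iff_of_nonneg (fun x => (hpos x).le) hw).mp h).exists
  exact (hpos x).ne' hx

lemma betaConst_pos {n : ℕ} (hn : 0 < n) : 0 < betaConst n := by
  have hn' : (0 : ℝ) < n := by exact_mod_cast hn
  have hball : 0 < volume.real (Metric.ball (0 : EuclideanSpace ℝ (Fin n)) 1) :=
    ENNReal.toReal_pos (Metric.measure_ball_pos _ _ one_pos).ne' measure_ball_lt_top.ne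
  unfold betaConst
  have h1 := Real.Gamma_pos_of_pos (by positivity : (0 : ℝ) < n / 2 + 1)
  have h2 := Real.Gamma_pos_of_pos (by positivity : (0 : ℝ) < n / 2)
  positivity

end Choquard

theorem lemma2p6 (n : ℕ) (hn : 2 ≤ n) (μ : ℝ) (hμ_pos : 0 < μ) (hμ_lt : μ < (n : ℝ))
    (u : EuclideanSpace ℝ (Fin n) → ℝ)
    (hu : ContDiff ℝ (n : WithTop ℕ∞) u)
    (hsol : Choquard.SolvesIntegralEquation μ u)
    (hα : MeasureTheory.Integrable (fun y : EuclideanSpace ℝ (Fin n) =>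
      Choquard.potential μ u y * Choquard.density μ u y))
    (hβ : MeasureTheory.Integrable (fun y : EuclideanSpace ℝ (Fin n) =>
      Choquard.density μ u y)) :
    Choquard.alpha μ u = 2 := by
  obtain ⟨C, hC⟩ := hsol
  have hfin : Module.finrank ℝ (EuclideanSpace ℝ (Fin n)) = n := by simp
  have hμ_lt' : μ < Module.finrank ℝ (EuclideanSpace ℝ (Fin n)) := by rwa [hfin]
  have hc : 0 < (2 * (n : ℝ) - μ) / 2 := by linarith
  have hbeta := Choquard.betaConst_pos (n := n) (by omega)
  have hmass := Choquard.mass_identity (by rw [hfin]; exact hn) hμ_pos hμ_lt' hc.le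
    (one_div_pos.mpr hbeta).le hu.continuous hβ rfl hα hC
  have : Nontrivial (EuclideanSpace ℝ (Fin n)) :=
    Module.nontrivial_of_finrank_pos (R := ℝ) (by rw [hfin]; omega)
  have hcont : Continuous fun y => Real.exp ((2 * (n : ℝ) - μ) / 2 * u y) :=
    Real.continuous_exp.comp (continuous_const.mul hu.continuous)
  have hpos := Choquard.integral_energyDensity_pos hμ_pos hμ_lt' hcont
    (fun _ => Real.exp_pos _) hβ hα
  rw [hfin] at hmass
  change 1 / Choquard.betaConst n * (∫ y, Choquard.energyDensity μ
    (fun y => Real.exp ((2 * (n : ℝ) - μ) / 2 * u y)) y) = 2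
  set W := ∫ y, Choquard.energyDensity μ (fun y => Real.exp ((2 * (n : ℝ) - μ) / 2 * u y)) y
  have hfac : (2 * (n : ℝ) - μ) / 2 * W * (2 - 1 / Choquard.betaConst n * W) = 0 := by
    linear_combination hmass
  have := (mul_eq_zero.mp hfac).resolve_left (mul_pos hc hpos).ne'
  linarith
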